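/- Let $\mathcal X,\mathcal Y$ be finite alphabets with $\mathcal X\neq\emptyset$ and $|\mathcal Y|\ge 2$. For a joint distribution $P_{XY}$ on $\mathcal X\times\mathcal Y$ let $I(X;Y)$ be its mutual information (natural logarithms), and let $\mathcal A$ be the set of those $P_{XY}$ for which $P_{X|Y}(x|y)$ is defined and positive for all $(x,y)$. The variational distance is $\|P-Q\|=\sup_A|P(A)-Q(A)|$. An $(n,R_n)$ coordination code is a pair of maps $f_n:\mathcal X^n\to\{1,\dots,M_n\}$, $g_n:\{1,\dots,M_n\}\to\mathcal Y^n$, with rate $R_n=\frac1n\log M_n$. Let $X^n$ be i.i.d. with law $P_X$, let $Y^n=g_n(f_n(X^n))$, and let $T_{x^ny^n}(x,y)=\frac1n\sum_{i=1}^n\mathbf 1\{(x_i,y_i)=(x,y)\}$ be the empirical distribution of $(x^n,y^n)$. A sequence of codes is good for $P_{Y|X}$ if $R_n\to I(X;Y)$ and $\|T_{X^nY^n}-P_{XY}\|\to0$ in probability. Let $P_{X^nY^n}$ be the law of $(X^n,Y^n)$, and let $$Q_{X^nY^n}(x^n,y^n)=\frac{|g_n^{-1}(y^n)|}{M_n}\prod_{i=1}^nP_{X|Y}(x_i|y_i)$$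 be the law of the output and input of the memoryless backward channel $P_{X|Y}$ when its input is a uniformly chosen codeword. **Theorem.** There exist $P_{XY}\in\mathcal A$ with $P_X(x)>0$ for all $x$ and a sequence of coordination codes that is good for the corresponding $P_{Y|X}$ such that $\|P_{X^nY^n}-Q_{X^nY^n}\|$ does not tend to $0$ as $n\to\infty$; for this sequence the unnormalized relative entropy $D(P_{X^nY^n}\|Q_{X^nY^n})$ does not tend to $0$ either. -/

import Mathlib

open Filter Topology
open scoped ENNReal

namespace CoordinationCoding

noncomputable section

/-! Distributions on a finite alphabet `α` are given by their probability mass functions, the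
elements of `stdSimplex ℝ α`. Logarithms are natural (in rates and in mutual information alike). -/

/-- Variational distance `‖P - Q‖ = sup_A |P(A) - Q(A)|` on a finite alphabet. -/
def variationalDistance {α : Type*} [Fintype α] (P Q : α → ℝ) : ℝ :=
  ⨆ A : Finset α, |∑ a ∈ A, P a - ∑ a ∈ A, Q a|

/-- The measure on the discrete space `α` with point masses `P a`. -/
def massMeasure {α : Type*} [Fintype α] (P : α → ℝ) : @MeasureTheory.Measure α ⊤ :=
  letI : MeasurableSpace α := ⊤
  ∑ a, ENNReal.ofReal (P a) • MeasureTheory.Measure.dirac a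

/-- (Unnormalized) relative entropy `D(P‖Q)`. -/
def relativeEntropy {α : Type*} [Fintype α] (P Q : α → ℝ) : ℝ≥0∞ :=
  letI : MeasurableSpace α := ⊤
  InformationTheory.klDiv (massMeasure P) (massMeasure Q)

section Joint

variable {𝒳 𝒴 : Type*} [Fintype 𝒳] [Fintype 𝒴]

/-- The marginal `P_X`. -/
def marginalX (P : 𝒳 × 𝒴 → ℝ) (x : 𝒳) : ℝ := ∑ y, P (x, y)

/-- The marginal `P_Y`. -/
def marginalY (P : 𝒳 × 𝒴 → ℝ) (y : 𝒴) : ℝ := ∑ x, P (x, y)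

/-- The backward channel `P_{X|Y}(x|y)`; it takes the value `0` where `P_Y(y) = 0`, i.e. where
the conditional distribution is not defined. -/
def backwardChannel (P : 𝒳 × 𝒴 → ℝ) (x : 𝒳) (y : 𝒴) : ℝ := P (x, y) / marginalY P y

/-- Mutual information `I(X;Y)` of `(X,Y) ∼ P`. -/
def mutualInformation (P : 𝒳 × 𝒴 → ℝ) : ℝ :=
  ∑ a : 𝒳 × 𝒴, P a * Real.log (P a / (marginalX P a.1 * marginalY P a.2))

variable (𝒳 𝒴) in
/-- The class `𝒜` of joint distributions with `P_{X|Y}(x|y) > 0` for all `(x, y)`. -/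
def positiveBackward : Set (𝒳 × 𝒴 → ℝ) :=
  {P | P ∈ stdSimplex ℝ (𝒳 × 𝒴) ∧ ∀ x y, 0 < backwardChannel P x y}

end Joint

/-- A coordination code of block length `n`: an encoder `f` and a decoder `g` with message set
of size `M`. -/
structure CoordinationCode (𝒳 𝒴 : Type*) (n : ℕ) where
  M : ℕ
  f : (Fin n → 𝒳) → Fin M
  g : Fin M → (Fin n → 𝒴)

/-- The rate `R_n = (1/n) log M`. -/
def CoordinationCode.rate {𝒳 𝒴 : Type*} {n : ℕ} (c : CoordinationCode 𝒳 𝒴 n) : ℝ :=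
  Real.log c.M / n

open Classical in
/-- The empirical distribution `T_{xⁿyⁿ}` of a pair of sequences. -/
def empirical {𝒳 𝒴 : Type*} {n : ℕ} (x : Fin n → 𝒳) (y : Fin n → 𝒴) (a : 𝒳 × 𝒴) : ℝ :=
  (1 / n : ℝ) * ∑ i, if (x i, y i) = a then 1 else 0

variable {𝒳 𝒴 : Type*} [Fintype 𝒳] [Fintype 𝒴]

/-- The memoryless source `P_{Xⁿ}(xⁿ) = ∏ P_X(x_i)`. -/
def sourceLaw (P : 𝒳 × 𝒴 → ℝ) {n : ℕ} (x : Fin n → 𝒳) : ℝ := ∏ i, marginalX P (x i)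

open Classical in
/-- The law `P_{XⁿYⁿ}` of `(Xⁿ, g(f(Xⁿ)))`. -/
def inducedLaw (P : 𝒳 × 𝒴 → ℝ) {n : ℕ} (c : CoordinationCode 𝒳 𝒴 n)
    (z : (Fin n → 𝒳) × (Fin n → 𝒴)) : ℝ :=
  sourceLaw P z.1 * if z.2 = c.g (c.f z.1) then 1 else 0

open Classical in
/-- The uniform distribution over the codebook, `Q_{Yⁿ}(yⁿ) = |g⁻¹(yⁿ)| / M`. -/
def codebookLaw {n : ℕ} (c : CoordinationCode 𝒳 𝒴 n) (y : Fin n → 𝒴) : ℝ :=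
  ((Finset.univ.filter fun m => c.g m = y).card : ℝ) / c.M

/-- The law `Q_{XⁿYⁿ} = Q_{Yⁿ} ∏ P_{X|Y}(x_i|y_i)` of a uniformly chosen codeword and the output
of the memoryless backward channel with that codeword as its input. -/
def backwardLaw (P : 𝒳 × 𝒴 → ℝ) {n : ℕ} (c : CoordinationCode 𝒳 𝒴 n)
    (z : (Fin n → 𝒳) × (Fin n → 𝒴)) : ℝ :=
  codebookLaw c z.2 * ∏ i, backwardChannel P (z.1 i) (z.2 i)

open Classical in
/-- The sequence of codes `c` is good for `P_{Y|X}` (with source `P_X`, where `P = P_X P_{Y|X}`):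
the rates converge to `I(X;Y)` and `‖T_{XⁿYⁿ} - P‖ → 0` in probability. -/
def IsGood (P : 𝒳 × 𝒴 → ℝ) (c : ∀ n, CoordinationCode 𝒳 𝒴 n) : Prop :=
  Tendsto (fun n => (c n).rate) atTop (𝓝 (mutualInformation P)) ∧
  ∀ ε : ℝ, 0 < ε →
    Tendsto (fun n : ℕ =>
      ∑ x : Fin n → 𝒳 with
          ε ≤ variationalDistance (empirical x ((c n).g ((c n).f x))) P,
        sourceLaw P x) atTop (𝓝 0)

end

end CoordinationCoding

open Filter Topology
open scoped ENNReal

namespace CoordinationCoding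

noncomputable section

/-! ### Variational distance on a finite alphabet. -/

section Variational

variable {α : Type*} [Fintype α]

/-! Goodness constrains only the codewords actually sent, while the backward law weights every
message equally. Doubling the message set costs rate `log 2 / n → 0`; if the new messages are never
sent and all decode to a constant word `w`, goodness survives, yet the backward law gives `Yⁿ = w`
mass at least 1/2. Under the induced law this event has vanishing mass: a joint type with `w` puts
no mass on letters absent from `w`, so it stays away from `P`. `not_tendsto_of_separating` turns
such an event into both failures of convergence, and `IsGood.exists_not_tendsto` performs this for
any `P ∈ 𝒜` with a good sequence.

One good sequence is still needed. For the uniform `P` the mutual information is 0, so no random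
coding is required: a single periodic codeword is good by Chebyshev's inequality
(`isGood_periodicCode`). -/

lemma le_variationalDistance (P Q : α → ℝ) (A : Finset α) :
    |∑ a ∈ A, P a - ∑ a ∈ A, Q a| ≤ variationalDistance P Q :=
  le_ciSup (f := fun A : Finset α => |∑ a ∈ A, P a - ∑ a ∈ A, Q a|) (Set.finite_range _).bddAbove A

lemma variationalDistance_le_sum_abs (P Q : α → ℝ) :
    variationalDistance P Q ≤ ∑ a, |P a - Q a| := by
  refine ciSup_le fun A => ?_
  rw [← Finset.sum_sub_distrib]
  exact (Finset.abs_sum_le_sum_abs _ _).trans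
    (Finset.sum_le_univ_sum_of_nonneg fun _ => abs_nonneg _)

end Variational

/-! ### Separating events and relative entropy. -/

section RelativeEntropy

open MeasureTheory InformationTheory

/-- The left-over expression is `x log x + 1`, with minimum `1 - 1/e`. Applying `log t ≥ 1 - 1/t` at
`t = 2x` gives the cruder 1/2, using only `log 2 ≤ 1`. -/
lemma half_le_klFun_add {x : ℝ} (hx : 0 ≤ x) : 1 / 2 ≤ klFun x + x := by
  rcases hx.eq_or_lt with rfl | hx
  · norm_num [klFun_zero]
  have h := Real.one_sub_inv_le_log_of_pos (x := 2 * x) (by positivity)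
  rw [Real.log_mul two_ne_zero hx.ne'] at h
  have h2 : x * (1 - (2 * x)⁻¹) ≤ x * (Real.log 2 + Real.log x) :=
    mul_le_mul_of_nonneg_left h hx.le
  have h3 : x * (1 - (2 * x)⁻¹) = x - 1 / 2 := by field_simp
  have h4 : x * Real.log 2 ≤ x * 1 :=
    mul_le_mul_of_nonneg_left (by linarith [Real.log_two_lt_d9]) hx.le
  rw [klFun_apply]
  linarith

/-- A small relative entropy forces an event that is unlikely under `μ` to be unlikely
under `ν`. -/
lemma measure_le_klDiv_add {α : Type*} [MeasurableSpace α] (μ ν : Measure α) [IsFiniteMeasure μ]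
    [IsFiniteMeasure ν] (s : Set α) : ENNReal.ofReal (1 / 2) * ν s ≤ klDiv μ ν + μ s := by
  by_cases hac : μ ≪ ν
  swap
  · simp [klDiv_of_not_ac hac]
  have hpt : ∀ r : ℝ≥0∞, ENNReal.ofReal (1 / 2) ≤ ENNReal.ofReal (klFun r.toReal) + r := by
    intro r
    by_cases hr : r = ∞
    · simp [hr]
    · have h := ENNReal.ofReal_le_ofReal (half_le_klFun_add (ENNReal.toReal_nonneg (a := r)))
      rwa [ENNReal.ofReal_add (klFun_nonneg ENNReal.toReal_nonneg) ENNReal.toReal_nonneg,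
        ENNReal.ofReal_toReal hr] at h
  calc ENNReal.ofReal (1 / 2) * ν s
      = ∫⁻ _ in s, ENNReal.ofReal (1 / 2) ∂ν := by rw [setLIntegral_const]
    _ ≤ ∫⁻ x in s, (ENNReal.ofReal (klFun (μ.rnDeriv ν x).toReal) + μ.rnDeriv ν x) ∂ν :=
        lintegral_mono fun x => hpt _
    _ = ∫⁻ x in s, ENNReal.ofReal (klFun (μ.rnDeriv ν x).toReal) ∂ν
          + ∫⁻ x in s, μ.rnDeriv ν x ∂ν :=
        lintegral_add_right _ (Measure.measurable_rnDeriv _ _)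
    _ ≤ klDiv μ ν + μ s := by
        rw [klDiv_eq_lintegral_klFun_of_ac hac]
        exact add_le_add (setLIntegral_le_lintegral _ _) (Measure.setLIntegral_rnDeriv_le s)

lemma massMeasure_coe {α : Type*} [Fintype α] {P : α → ℝ} (hP : ∀ a, 0 ≤ P a) (A : Finset α) :
    massMeasure P (A : Set α) = ENNReal.ofReal (∑ a ∈ A, P a) := by
  classical
  let _ : MeasurableSpace α := ⊤
  rw [ENNReal.ofReal_sum_of_nonneg fun a _ => hP a, massMeasure, Measure.finsetSum_apply]
  simp [Set.indicator_apply, Finset.sum_ite_mem]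

lemma half_sum_le_relativeEntropy_add {α : Type*} [Fintype α] {P Q : α → ℝ}
    (hP : ∀ a, 0 ≤ P a) (hQ : ∀ a, 0 ≤ Q a) (A : Finset α) :
    ENNReal.ofReal (1 / 2) * ENNReal.ofReal (∑ a ∈ A, Q a)
      ≤ relativeEntropy P Q + ENNReal.ofReal (∑ a ∈ A, P a) := by
  let _ : MeasurableSpace α := ⊤
  have hfin : ∀ R : α → ℝ, (∀ a, 0 ≤ R a) → IsFiniteMeasure (massMeasure R) := fun R hR =>
    ⟨by rw [← Finset.coe_univ, massMeasure_coe hR]; exact ENNReal.ofReal_lt_top⟩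
  have := hfin P hP
  have := hfin Q hQ
  rw [← massMeasure_coe hP, ← massMeasure_coe hQ]
  exact measure_le_klDiv_add (massMeasure P) (massMeasure Q) (A : Set α)

/-- Events whose probability vanishes under `P n` but not under `Q n` separate the two sequences,
in variational distance and in relative entropy. -/
lemma not_tendsto_of_separating {α : ℕ → Type*} [∀ n, Fintype (α n)] {P Q : ∀ n, α n → ℝ}
    (hP : ∀ n a, 0 ≤ P n a) (hQ : ∀ n a, 0 ≤ Q n a) (A : ∀ n, Finset (α n))
    (hPA : Tendsto (fun n => ∑ a ∈ A n, P n a) atTop (𝓝 0)) {δ : ℝ} (hδ : 0 < δ)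
    (hQA : ∀ᶠ n in atTop, δ ≤ ∑ a ∈ A n, Q n a) :
    ¬ Tendsto (fun n => variationalDistance (P n) (Q n)) atTop (𝓝 0) ∧
      ¬ Tendsto (fun n => relativeEntropy (P n) (Q n)) atTop (𝓝 0) := by
  constructor
  · intro h
    have h0 := h.add hPA
    rw [add_zero] at h0
    refine absurd (ge_of_tendsto h0 (hQA.mono fun n hn => ?_)) (not_le.mpr hδ)
    have := (abs_le.mp (le_variationalDistance (P n) (Q n) (A n))).1
    linarith
  · intro h
    have h0 := h.add (ENNReal.tendsto_ofReal hPA)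
    rw [ENNReal.ofReal_zero, add_zero] at h0
    have hpos : 0 < ENNReal.ofReal (1 / 2) * ENNReal.ofReal δ :=
      ENNReal.mul_pos (by simp) (by simpa using hδ)
    refine absurd (ge_of_tendsto h0 (hQA.mono fun n hn => ?_)) (not_le.mpr hpos)
    exact (mul_le_mul_right (ENNReal.ofReal_le_ofReal hn) _).trans
      (half_sum_le_relativeEntropy_add (hP n) (hQ n) (A n))

end RelativeEntropy

/-! ### Padding a code with unused messages. -/

section Padding

/-- The code obtained by doubling the message set: the new messages are never sent and are all
decoded to the word `w`. -/
def CoordinationCode.pad {𝒳 𝒴 : Type*} {n : ℕ} (c : CoordinationCode 𝒳 𝒴 n) (w : Fin n → 𝒴) :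
    CoordinationCode 𝒳 𝒴 n where
  M := c.M + c.M
  f x := Fin.castAdd c.M (c.f x)
  g := Fin.append c.g fun _ => w

@[simp]
lemma CoordinationCode.pad_g_f {𝒳 𝒴 : Type*} {n : ℕ} (c : CoordinationCode 𝒳 𝒴 n)
    (w : Fin n → 𝒴) (x : Fin n → 𝒳) : (c.pad w).g ((c.pad w).f x) = c.g (c.f x) :=
  Fin.append_left c.g (fun _ => w) (c.f x)

lemma CoordinationCode.M_pos {𝒳 𝒴 : Type*} [Nonempty 𝒳] {n : ℕ} (c : CoordinationCode 𝒳 𝒴 n) :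
    0 < c.M :=
  Fin.pos (c.f Classical.ofNonempty)

lemma CoordinationCode.rate_pad {𝒳 𝒴 : Type*} [Nonempty 𝒳] {n : ℕ}
    (c : CoordinationCode 𝒳 𝒴 n) (w : Fin n → 𝒴) :
    (c.pad w).rate = Real.log 2 / n + c.rate := by
  have h : (c.M : ℝ) ≠ 0 := by exact_mod_cast c.M_pos.ne'
  have h2 : ((c.pad w).M : ℝ) = 2 * c.M := by
    simp only [pad]
    push_cast
    ring
  rw [rate, rate, h2, Real.log_mul two_ne_zero h, add_div]

open Classical in
-- The added messages are half of all messages. Equality may fail because the original code may use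
-- `w` too.
lemma half_le_codebookLaw_pad {𝒳 𝒴 : Type*} [Nonempty 𝒳] {n : ℕ}
    (c : CoordinationCode 𝒳 𝒴 n) (w : Fin n → 𝒴) : 1 / 2 ≤ codebookLaw (c.pad w) w := by
  have hM : (0 : ℝ) < c.M := by exact_mod_cast c.M_pos
  have hcard : c.M ≤ (Finset.univ.filter fun m => (c.pad w).g m = w).card := by
    conv_lhs => rw [← Fintype.card_fin c.M, ← Finset.card_univ]
    refine Finset.card_le_card_of_injOn (fun j => (Fin.natAdd c.M j : Fin (c.M + c.M)))
      (fun j _ => ?_) ((Fin.natAdd_injective _ _).injOn)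
    exact Finset.mem_coe.mpr (Finset.mem_filter.mpr
      ⟨Finset.mem_univ _, Fin.append_right c.g (fun _ => w) j⟩)
  have h2 : ((c.pad w).M : ℝ) = 2 * c.M := by
    simp only [CoordinationCode.pad]
    push_cast
    ring
  have hcard' : (c.M : ℝ) ≤ ((Finset.univ.filter fun m => (c.pad w).g m = w).card : ℝ) := by
    exact_mod_cast hcard
  rw [codebookLaw, le_div_iff₀ (by rw [h2]; positivity), h2]
  linarith

lemma sourceLaw_nonneg {𝒳 𝒴 : Type*} [Fintype 𝒴] {P : 𝒳 × 𝒴 → ℝ} (hP : ∀ a, 0 ≤ P a) {n : ℕ} (x : Fin n → 𝒳) :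
    0 ≤ sourceLaw P x :=
  Finset.prod_nonneg fun _ _ => Finset.sum_nonneg fun _ _ => hP _

variable {𝒳 𝒴 : Type*} [Fintype 𝒳] [Fintype 𝒴]

lemma pos_of_mem_positiveBackward {P : 𝒳 × 𝒴 → ℝ} (hP : P ∈ positiveBackward 𝒳 𝒴) (a : 𝒳 × 𝒴) :
    0 < P a := by
  refine (hP.1.1 a).lt_of_ne fun h => ?_
  have := hP.2 a.1 a.2
  simp [backwardChannel, ← h] at this

lemma sum_backwardChannel [Nonempty 𝒳] {P : 𝒳 × 𝒴 → ℝ} (hP : P ∈ positiveBackward 𝒳 𝒴) (y : 𝒴) :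
    ∑ x, backwardChannel P x y = 1 := by
  have h : 0 < marginalY P y :=
    Finset.sum_pos (fun _ _ => pos_of_mem_positiveBackward hP _) Finset.univ_nonempty
  simp only [backwardChannel]
  rw [← Finset.sum_div]
  exact div_self h.ne'

lemma sum_prod_apply {α R : Type*} [Fintype α] [CommSemiring R] {n : ℕ} (h : Fin n → α → R) :
    ∑ x : Fin n → α, ∏ i, h i (x i) = ∏ i, ∑ a, h i a := by
  classical
  rw [Finset.prod_univ_sum, Fintype.piFinset_univ]

open Classical in
lemma sum_inducedLaw_word (P : 𝒳 × 𝒴 → ℝ) {n : ℕ} (c : CoordinationCode 𝒳 𝒴 n)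
    (w : Fin n → 𝒴) :
    ∑ z ∈ (Finset.univ : Finset (Fin n → 𝒳)) ×ˢ {w}, inducedLaw P c z
      = ∑ x : Fin n → 𝒳 with c.g (c.f x) = w, sourceLaw P x := by
  rw [Finset.sum_product, Finset.sum_filter]
  refine Finset.sum_congr rfl fun x _ => ?_
  rw [Finset.sum_singleton]
  simp [inducedLaw, eq_comm]

open Classical in
lemma sum_backwardLaw_word [Nonempty 𝒳] {P : 𝒳 × 𝒴 → ℝ} (hP : P ∈ positiveBackward 𝒳 𝒴) {n : ℕ}
    (c : CoordinationCode 𝒳 𝒴 n) (w : Fin n → 𝒴) :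
    ∑ z ∈ (Finset.univ : Finset (Fin n → 𝒳)) ×ˢ {w}, backwardLaw P c z = codebookLaw c w := by
  rw [Finset.sum_product]
  simp only [Finset.sum_singleton, backwardLaw]
  rw [← Finset.mul_sum, sum_prod_apply fun i a => backwardChannel P a (w i)]
  simp [sum_backwardChannel hP]

/-- The joint type of any word with a constant word stays away from `P`. -/
lemma le_variationalDistance_empirical_const {P : 𝒳 × 𝒴 → ℝ} {x₀ : 𝒳} {y₀ y₁ : 𝒴} (hy : y₀ ≠ y₁)
    {n : ℕ} (x : Fin n → 𝒳) :
    P (x₀, y₁) ≤ variationalDistance (empirical x fun _ => y₀) P := by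
  have h := le_variationalDistance (empirical x fun _ => y₀) P {(x₀, y₁)}
  have h0 : empirical x (fun _ => y₀) (x₀, y₁) = 0 := by simp [empirical, hy]
  rw [Finset.sum_singleton, Finset.sum_singleton, h0] at h
  linarith [(abs_le.mp h).1]

/-- Every `P ∈ 𝒜` that admits a good sequence of codes admits one whose induced distribution stays
away from the output of the backward channel. -/
lemma IsGood.exists_not_tendsto [Nonempty 𝒳] [Nontrivial 𝒴] {P : 𝒳 × 𝒴 → ℝ}
    (hP : P ∈ positiveBackward 𝒳 𝒴) {c : ∀ n, CoordinationCode 𝒳 𝒴 n} (hc : IsGood P c) :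
    ∃ c' : ∀ n, CoordinationCode 𝒳 𝒴 n, IsGood P c' ∧
      ¬ Tendsto (fun n => variationalDistance (inducedLaw P (c' n)) (backwardLaw P (c' n)))
        atTop (𝓝 0) ∧
      ¬ Tendsto (fun n => relativeEntropy (inducedLaw P (c' n)) (backwardLaw P (c' n)))
        atTop (𝓝 0) := by
  classical
  obtain ⟨y₀, y₁, hy⟩ := exists_pair_ne 𝒴
  let x₀ : 𝒳 := Classical.ofNonempty
  refine ⟨fun n => (c n).pad fun _ => y₀, ⟨?_, fun ε hε => ?_⟩, ?_⟩
  · simp only [CoordinationCode.rate_pad]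
    simpa using (tendsto_const_div_atTop_nhds_zero_nat (Real.log 2)).add hc.1
  · simpa only [CoordinationCode.pad_g_f] using hc.2 ε hε
  · refine not_tendsto_of_separating (δ := 1 / 2) (fun n z => ?_) (fun n z => ?_)
      (fun n => Finset.univ ×ˢ {fun _ => y₀}) ?_ (by norm_num) (Eventually.of_forall fun n => ?_)
    · exact mul_nonneg (sourceLaw_nonneg hP.1.1 _) (by split_ifs <;> norm_num)
    · exact mul_nonneg (div_nonneg (Nat.cast_nonneg _) (Nat.cast_nonneg _))
        (Finset.prod_nonneg fun _ _ => (hP.2 _ _).le)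
    · simp only [sum_inducedLaw_word, CoordinationCode.pad_g_f]
      -- Goodness is used at the fixed radius `P (x₀, y₁)`: decoding to the constant word forces a
      -- deviation at least that large.
      refine squeeze_zero (fun n => Finset.sum_nonneg fun x _ => sourceLaw_nonneg hP.1.1 x)
        (fun n => ?_) (hc.2 (P (x₀, y₁)) (pos_of_mem_positiveBackward hP _))
      refine Finset.sum_le_sum_of_subset_of_nonneg (fun x hx => ?_)
        fun x _ _ => sourceLaw_nonneg hP.1.1 x
      rw [Finset.mem_filter] at hx ⊢
      refine ⟨hx.1, ?_⟩
      rw [hx.2]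
      exact le_variationalDistance_empirical_const hy x
    · rw [sum_backwardLaw_word hP]
      exact half_le_codebookLaw_pad _ _

end Padding

/-! ### Second moments under a product law. -/

section SecondMoment

variable {α : Type*} [Fintype α] {n : ℕ}

lemma sum_prod_weights_eq_one {q : α → ℝ} (hq : ∑ a, q a = 1) :
    ∑ x : Fin n → α, ∏ i, q (x i) = 1 := by
  rw [sum_prod_apply fun _ a => q a]
  simp [hq]

lemma sum_prod_weights_mul_mul {q : α → ℝ} {Z : Fin n → α → ℝ}
    (hZ : ∀ i, ∑ a, q a * Z i a = 0) {i j : Fin n} (hij : i ≠ j) :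
    ∑ x : Fin n → α, (∏ k, q (x k)) * (Z i (x i) * Z j (x j)) = 0 := by
  -- Writing the cross term as a product over coordinates lets the sum factor; the factor at `i` is
  -- the mean of `Z i`, which is zero.
  have h : ∀ x : Fin n → α, (∏ k, q (x k)) * (Z i (x i) * Z j (x j))
      = ∏ k, (q (x k) * (if k = i then Z k (x k) else 1) * (if k = j then Z k (x k) else 1)) := by
    intro x
    rw [Finset.prod_mul_distrib, Finset.prod_mul_distrib]
    simp [mul_assoc]
  simp only [h]
  rw [sum_prod_apply fun k a =>
    q a * (if k = i then Z k a else 1) * (if k = j then Z k a else 1)]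
  exact Finset.prod_eq_zero (Finset.mem_univ i) (by simp [hij, hZ])

/-- The second moment of a sum of independent centred variables bounded by one. -/
lemma sum_prod_weights_mul_sq_le {q : α → ℝ} (hq0 : ∀ a, 0 ≤ q a) (hq : ∑ a, q a = 1)
    {Z : Fin n → α → ℝ} (hZ : ∀ i, ∑ a, q a * Z i a = 0) (hZ1 : ∀ i a, |Z i a| ≤ 1) :
    ∑ x : Fin n → α, (∏ k, q (x k)) * (∑ i, Z i (x i)) ^ 2 ≤ n := by
  have h : ∀ i j : Fin n, ∑ x : Fin n → α, (∏ k, q (x k)) * (Z i (x i) * Z j (x j))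
      ≤ if i = j then 1 else 0 := by
    intro i j
    split_ifs with hij
    · subst hij
      rw [← sum_prod_weights_eq_one (n := n) hq]
      refine Finset.sum_le_sum fun x _ =>
        mul_le_of_le_one_right (Finset.prod_nonneg fun _ _ => hq0 _) ?_
      rw [← sq, sq_le_one_iff_abs_le_one]
      exact hZ1 i _
    · exact (sum_prod_weights_mul_mul hZ hij).le
  calc ∑ x : Fin n → α, (∏ k, q (x k)) * (∑ i, Z i (x i)) ^ 2
      = ∑ i, ∑ j, ∑ x : Fin n → α, (∏ k, q (x k)) * (Z i (x i) * Z j (x j)) := by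
        have h2 : ∀ x : Fin n → α, (∏ k, q (x k)) * (∑ i, Z i (x i)) ^ 2
            = ∑ i, ∑ j, (∏ k, q (x k)) * (Z i (x i) * Z j (x j)) := fun x => by
          rw [sq, Finset.sum_mul_sum, Finset.mul_sum]
          exact Finset.sum_congr rfl fun i _ => Finset.mul_sum _ _ _
        rw [Finset.sum_congr rfl fun x _ => h2 x, Finset.sum_comm]
        exact Finset.sum_congr rfl fun i _ => Finset.sum_comm
    _ ≤ ∑ i : Fin n, ∑ j : Fin n, if i = j then (1 : ℝ) else 0 :=
        Finset.sum_le_sum fun i _ => Finset.sum_le_sum fun j _ => h i j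
    _ = n := by simp

end SecondMoment

/-! ### A good code for the uniform law. -/

section Uniform

variable (𝒳 𝒴 : Type*) [Fintype 𝒳] [Fintype 𝒴]

/-- The uniform distribution on `𝒳 × 𝒴`. -/
def uniformLaw (_ : 𝒳 × 𝒴) : ℝ := 1 / (Fintype.card 𝒳 * Fintype.card 𝒴)

variable {𝒳 𝒴}

lemma marginalX_uniformLaw [Nonempty 𝒴] (x : 𝒳) :
    marginalX (uniformLaw 𝒳 𝒴) x = 1 / Fintype.card 𝒳 := by
  simp [marginalX, uniformLaw]

lemma marginalY_uniformLaw [Nonempty 𝒳] (y : 𝒴) :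
    marginalY (uniformLaw 𝒳 𝒴) y = 1 / Fintype.card 𝒴 := by
  simp only [marginalY, uniformLaw, Finset.sum_const, Finset.card_univ, nsmul_eq_mul]
  field_simp

lemma uniformLaw_mem_positiveBackward [Nonempty 𝒳] [Nonempty 𝒴] :
    uniformLaw 𝒳 𝒴 ∈ positiveBackward 𝒳 𝒴 := by
  have hX : (0 : ℝ) < Fintype.card 𝒳 := by exact_mod_cast Fintype.card_pos
  have hY : (0 : ℝ) < Fintype.card 𝒴 := by exact_mod_cast Fintype.card_pos
  refine ⟨⟨fun a => ?_, ?_⟩, fun x y => ?_⟩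
  · unfold uniformLaw
    positivity
  · simp only [uniformLaw, Finset.sum_const, Finset.card_univ, Fintype.card_prod, nsmul_eq_mul]
    push_cast
    field_simp
  · rw [backwardChannel, marginalY_uniformLaw]
    unfold uniformLaw
    positivity

lemma mutualInformation_uniformLaw [Nonempty 𝒳] [Nonempty 𝒴] :
    mutualInformation (uniformLaw 𝒳 𝒴) = 0 := by
  refine Finset.sum_eq_zero fun a _ => ?_
  rw [marginalX_uniformLaw, marginalY_uniformLaw, uniformLaw, one_div_mul_one_div,
    div_self (by positivity), Real.log_one, mul_zero]

/-- The word that runs periodically through the whole alphabet. -/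
def periodicWord (𝒴 : Type*) [Fintype 𝒴] [Nonempty 𝒴] (n : ℕ) (i : Fin n) : 𝒴 :=
  (Fintype.equivFin 𝒴).symm ⟨i % Fintype.card 𝒴, Nat.mod_lt _ Fintype.card_pos⟩

open Classical in
-- A residue class modulo `k` meets `0, …, n - 1` in `⌊n/k⌋` or `⌊n/k⌋ + 1` points.
lemma abs_count_periodicWord_sub_le [Nonempty 𝒴] (n : ℕ) (y : 𝒴) :
    |∑ i, (if periodicWord 𝒴 n i = y then (1 : ℝ) else 0) - n / Fintype.card 𝒴| ≤ 1 := by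
  set k := Fintype.card 𝒴 with hk
  have hk0 : 0 < k := Fintype.card_pos
  set v : ℕ := (Fintype.equivFin 𝒴 y).val with hv
  have hvk : v < k := (Fintype.equivFin 𝒴 y).2
  have hiff : ∀ i : Fin n, periodicWord 𝒴 n i = y ↔ (i : ℕ) ≡ v [MOD k] := by
    intro i
    rw [periodicWord, Equiv.symm_apply_eq, Fin.ext_iff, Nat.ModEq, Nat.mod_eq_of_lt hvk]
  have hcount : ∑ i, (if periodicWord 𝒴 n i = y then (1 : ℝ) else 0)
      = (n.count (· ≡ v [MOD k]) : ℕ) := by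
    simp only [hiff]
    rw [Fin.sum_univ_eq_sum_range (fun i => if i ≡ v [MOD k] then (1 : ℝ) else 0) n,
      Nat.count_eq_card_filter_range, Finset.sum_boole]
  rw [hcount, Nat.count_modEq_card _ hk0]
  have hk' : (0 : ℝ) < k := by exact_mod_cast hk0
  have hdiv : (n : ℝ) / k = (n / k : ℕ) + (n % k : ℕ) / (k : ℝ) := by
    rw [eq_comm, ← sub_eq_zero]
    have : (n : ℝ) = k * (n / k : ℕ) + (n % k : ℕ) := by exact_mod_cast (Nat.div_add_mod n k).symm
    field_simp
    linarith
  have h0 : (0 : ℝ) ≤ (n % k : ℕ) / (k : ℝ) := by positivity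
  have h1 : ((n % k : ℕ) : ℝ) / k ≤ 1 := by
    rw [div_le_one hk']
    exact_mod_cast (Nat.mod_lt n hk0).le
  rw [hdiv, abs_le]
  push_cast
  split_ifs <;> constructor <;> linarith

/-- Mean square deviation of the joint type of a uniform source word and the periodic word. -/
lemma sum_sourceLaw_mul_sq_empirical_sub_le [Nonempty 𝒳] [Nonempty 𝒴] {n : ℕ} (hn : 0 < n)
    (a : 𝒳 × 𝒴) :
    ∑ x : Fin n → 𝒳, sourceLaw (uniformLaw 𝒳 𝒴) x *
      (empirical x (periodicWord 𝒴 n) a - uniformLaw 𝒳 𝒴 a) ^ 2 ≤ 4 / n := by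
  classical
  obtain ⟨x₀, y⟩ := a
  have hn' : (1 : ℝ) ≤ n := by exact_mod_cast hn
  have hX : (1 : ℝ) ≤ Fintype.card 𝒳 := by exact_mod_cast Nat.succ_le_of_lt Fintype.card_pos
  have hY : (0 : ℝ) < Fintype.card 𝒴 := by exact_mod_cast Fintype.card_pos
  set p : ℝ := 1 / Fintype.card 𝒳 with hp
  have hp0 : 0 ≤ p := by positivity
  have hp1 : p ≤ 1 := (div_le_one (by linarith)).mpr hX
  have hq : ∑ _a : 𝒳, p = 1 := by
    simp [hp]
  set ind : Fin n → ℝ := fun i => if periodicWord 𝒴 n i = y then 1 else 0 with hind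
  have hind01 : ∀ i, ind i = 0 ∨ ind i = 1 := fun i => by
    simp only [hind]; split_ifs <;> simp
  set Z : Fin n → 𝒳 → ℝ := fun i x => ind i * ((if x = x₀ then 1 else 0) - p) with hZdef
  have hZ : ∀ i, ∑ x, p * Z i x = 0 := by
    intro i
    simp only [hZdef]
    -- `Z i` is the centred indicator of `x₀`, switched on only where the periodic word equals `y`.
    rw [← Finset.mul_sum, ← Finset.mul_sum, Finset.sum_sub_distrib, hq]
    simp
  have hZ1 : ∀ i x, |Z i x| ≤ 1 := by
    intro i x
    simp only [hZdef]
    rw [abs_le]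
    rcases hind01 i with h | h <;> rw [h] <;> split_ifs <;> constructor <;> linarith
  have hE := sum_prod_weights_mul_sq_le (q := fun _ => p) (fun _ => hp0) hq hZ hZ1
  -- The deterministic part of the deviation: the bias left when `n` is not a multiple of the
  -- alphabet size.
  set d : ℝ := p * (∑ i, ind i - n / Fintype.card 𝒴) with hd
  have hd1 : d ^ 2 ≤ 1 := by
    rw [sq_le_one_iff_abs_le_one, hd, abs_mul, abs_of_nonneg hp0]
    exact mul_le_one₀ hp1 (abs_nonneg _) (abs_count_periodicWord_sub_le n y)
  have hdecomp : ∀ x : Fin n → 𝒳, empirical x (periodicWord 𝒴 n) (x₀, y) - uniformLaw 𝒳 𝒴 (x₀, y)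
      = (∑ i, Z i (x i) + d) / n := by
    intro x
    have h1 : ∑ i, (if (x i, periodicWord 𝒴 n i) = (x₀, y) then (1 : ℝ) else 0)
        = ∑ i, Z i (x i) + p * ∑ i, ind i := by
      rw [Finset.mul_sum, ← Finset.sum_add_distrib]
      refine Finset.sum_congr rfl fun i _ => ?_
      simp only [hZdef, hind, Prod.mk.injEq, ite_and]
      split_ifs <;> ring
    have h2 : uniformLaw 𝒳 𝒴 (x₀, y) = p * (n / Fintype.card 𝒴) / n := by
      rw [uniformLaw, hp]
      field_simp
    have h3 : empirical x (periodicWord 𝒴 n) (x₀, y)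
        = (∑ i, Z i (x i) + p * ∑ i, ind i) / n := by
      rw [← h1, empirical, one_div_mul_eq_div]
    rw [h3, h2, hd]
    ring
  have hs : ∀ x : Fin n → 𝒳, sourceLaw (uniformLaw 𝒳 𝒴) x = ∏ _i : Fin n, p := fun x => by
    simp only [sourceLaw, marginalX_uniformLaw, hp]
  have hone := sum_prod_weights_eq_one (n := n) (q := fun _ : 𝒳 => p) hq
  have hw : 0 ≤ ∏ _i : Fin n, p := Finset.prod_nonneg fun _ _ => hp0
  calc ∑ x : Fin n → 𝒳, sourceLaw (uniformLaw 𝒳 𝒴) x *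
        (empirical x (periodicWord 𝒴 n) (x₀, y) - uniformLaw 𝒳 𝒴 (x₀, y)) ^ 2
      ≤ ∑ x : Fin n → 𝒳, (2 / n ^ 2 * ((∏ _i : Fin n, p) * (∑ i, Z i (x i)) ^ 2)
          + 2 / n ^ 2 * ∏ _i : Fin n, p) := by
        refine Finset.sum_le_sum fun x _ => ?_
        have h1 : (∑ i, Z i (x i) + d) ^ 2 ≤ 2 * ((∑ i, Z i (x i)) ^ 2 + 1) := by
          linarith [sq_nonneg (∑ i, Z i (x i) - d)]
        calc _ = (∏ _i : Fin n, p) * (∑ i, Z i (x i) + d) ^ 2 / n ^ 2 := by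
              rw [hs, hdecomp, div_pow, mul_div_assoc]
          _ ≤ (∏ _i : Fin n, p) * (2 * ((∑ i, Z i (x i)) ^ 2 + 1)) / n ^ 2 := by gcongr
          _ = _ := by ring
    _ ≤ 2 / n ^ 2 * n + 2 / n ^ 2 * 1 := by
        rw [Finset.sum_add_distrib, ← Finset.mul_sum,
          ← Finset.mul_sum Finset.univ (fun _ : Fin n → 𝒳 => ∏ _i : Fin n, p), hone]
        gcongr
    _ ≤ 4 / n := by
        rw [← mul_add, div_mul_eq_mul_div, div_le_div_iff₀ (by positivity) (by positivity)]
        nlinarith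

/-- The code with the periodic word as its only codeword. -/
def periodicCode (𝒳 𝒴 : Type*) [Fintype 𝒴] [Nonempty 𝒴] (n : ℕ) : CoordinationCode 𝒳 𝒴 n where
  M := 1
  f _ := 0
  g _ := periodicWord 𝒴 n

lemma isGood_periodicCode [Nonempty 𝒳] [Nonempty 𝒴] :
    IsGood (uniformLaw 𝒳 𝒴) (periodicCode 𝒳 𝒴) := by
  classical
  set P := uniformLaw 𝒳 𝒴
  have hP0 : ∀ a, 0 ≤ P a := uniformLaw_mem_positiveBackward.1.1
  refine ⟨?_, fun ε hε => ?_⟩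
  · rw [mutualInformation_uniformLaw]
    simp [CoordinationCode.rate, periodicCode]
  set K : ℝ := ((Fintype.card (𝒳 × 𝒴) : ℕ) : ℝ)
  refine squeeze_zero' (g := fun n : ℕ => K ^ 2 * 4 / ε ^ 2 / n)
    (Eventually.of_forall fun n => Finset.sum_nonneg fun x _ => sourceLaw_nonneg hP0 x)
    ((eventually_gt_atTop 0).mono fun n hn => ?_) (tendsto_const_div_atTop_nhds_zero_nat _)
  change ∑ x : Fin n → 𝒳 with ε ≤ variationalDistance (empirical x (periodicWord 𝒴 n)) P,
    sourceLaw P x ≤ _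
  -- Cauchy–Schwarz passes from the sum of absolute deviations to squares and costs one factor `K`;
  -- the second `K` below counts the letters.
  have hpt : ∀ x : Fin n → 𝒳, ε ≤ variationalDistance (empirical x (periodicWord 𝒴 n)) P →
      ε ^ 2 ≤ K * ∑ a, (empirical x (periodicWord 𝒴 n) a - P a) ^ 2 := by
    intro x hx
    have h1 := hx.trans (variationalDistance_le_sum_abs _ _)
    have h2 := sq_sum_le_card_mul_sum_sq (s := Finset.univ)
      (f := fun a => |empirical x (periodicWord 𝒴 n) a - P a|)
    simp only [sq_abs, Finset.card_univ] at h2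
    exact (pow_le_pow_left₀ hε.le h1 2).trans h2
  have hmarkov : ε ^ 2 * ∑ x : Fin n → 𝒳 with
      ε ≤ variationalDistance (empirical x (periodicWord 𝒴 n)) P, sourceLaw P x
      ≤ K ^ 2 * (4 / n) := by
    calc _ ≤ ∑ x : Fin n → 𝒳, sourceLaw P x *
          (K * ∑ a, (empirical x (periodicWord 𝒴 n) a - P a) ^ 2) := by
          rw [Finset.mul_sum, Finset.sum_filter]
          refine Finset.sum_le_sum fun x _ => ?_
          split_ifs with h
          · rw [mul_comm]
            exact mul_le_mul_of_nonneg_left (hpt x h) (sourceLaw_nonneg hP0 x)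
          · exact mul_nonneg (sourceLaw_nonneg hP0 x) (mul_nonneg (Nat.cast_nonneg _)
              (Finset.sum_nonneg fun _ _ => sq_nonneg _))
      _ = K * ∑ a, ∑ x : Fin n → 𝒳, sourceLaw P x *
            (empirical x (periodicWord 𝒴 n) a - P a) ^ 2 := by
          rw [Finset.sum_comm, Finset.mul_sum]
          refine Finset.sum_congr rfl fun x _ => ?_
          rw [← Finset.mul_sum, mul_left_comm]
      _ ≤ K * ∑ _a : 𝒳 × 𝒴, 4 / (n : ℝ) :=
          mul_le_mul_of_nonneg_left
            (Finset.sum_le_sum fun a _ => sum_sourceLaw_mul_sq_empirical_sub_le hn a)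
            (Nat.cast_nonneg _)
      _ = K ^ 2 * (4 / n) := by
          rw [Finset.sum_const, Finset.card_univ, nsmul_eq_mul]
          ring
  have hε2 : 0 < ε ^ 2 := by positivity
  rw [mul_comm, ← le_div_iff₀ hε2] at hmarkov
  refine hmarkov.trans_eq ?_
  ring

end Uniform

end

end CoordinationCoding

theorem mainTheorem3 (𝒳 𝒴 : Type*) [Fintype 𝒳] [Fintype 𝒴] [Nonempty 𝒳] [Nontrivial 𝒴] :
    ∃ P ∈ CoordinationCoding.positiveBackward 𝒳 𝒴,
      (∀ x, 0 < CoordinationCoding.marginalX P x) ∧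
      ∃ c : ∀ n, CoordinationCoding.CoordinationCode 𝒳 𝒴 n,
        CoordinationCoding.IsGood P c ∧
        ¬ Tendsto (fun n => CoordinationCoding.variationalDistance
            (CoordinationCoding.inducedLaw P (c n)) (CoordinationCoding.backwardLaw P (c n)))
          atTop (𝓝 0) ∧
        ¬ Tendsto (fun n => CoordinationCoding.relativeEntropy
            (CoordinationCoding.inducedLaw P (c n)) (CoordinationCoding.backwardLaw P (c n)))
          atTop (𝓝 0) := by
  have hmem := CoordinationCoding.uniformLaw_mem_positiveBackward (𝒳 := 𝒳) (𝒴 := 𝒴)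
  refine ⟨CoordinationCoding.uniformLaw 𝒳 𝒴, hmem, fun x => ?_,
    CoordinationCoding.isGood_periodicCode.exists_not_tendsto hmem⟩
  exact Finset.sum_pos (fun _ _ => CoordinationCoding.pos_of_mem_positiveBackward hmem _)
    Finset.univ_nonempty
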